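/- **Setting.** Let $\zeta^{-1}=2\arctan(\sqrt2/5)$ (the solid angle of a regular tetrahedron at a vertex), $pt=2/\zeta-\pi/3$, $\delta_{oct}=(\pi-2/\zeta)/\sqrt8$, $t_0=1.255$. Let $\Lambda\subset\mathbb R^3$ be a saturated packing: distinct points of $\Lambda$ ("vertices") have distance at least $2$, and every point of $\mathbb R^3$ has distance less than $2$ from some vertex. *Quasi-regular* triangles and tetrahedra are sets of three, respectively four, vertices with all distances at most $2.51$. A *strict quarter* is a set of four vertices with one pair (its *diagonal*) at distance in $(2.51,\sqrt8)$ and the other five distances at most $2.51$. An *anchor* of a diagonal is a vertex at distance at most $2.51$ from both of its endpoints. A *quartered octahedron* along a diagonal $\{p,q\}$ is a set of six vertices $p,q,a,b,c,e$ such that $\{p,q\}$ with each of $\{a,b\},\{b,c\},\{c,e\},\{e,a\}$ is a strict quarter with diagonal $\{p,q\}$. Simplices overlap if their interiors meet. The *Q-system* consists of (1) all quasi-regular tetrahedra; (2) each strict quarter such that no strict quarter along its diagonal overlaps another quasi-regular tetrahedron or strict quarter; (3) each strict quarter whose diagonal has at least four anchors, unless it has exactly four and they are arranged as a quartered octahedron;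 (4) the four quarters along one fixed choice of diagonal in each quartered octahedron; (5) each strict quarter $\{p,q,a,b\}$ whose diagonal $\{p,q\}$ has exactly three anchors $a,b,c$ such that, for some naming of them, $2.51<|b-c|<\sqrt8$, the anchors of $\{b,c\}$ are exactly $p,q,a$, and the dihedral angles along $\{p,q\}$ between $a,b$ and between $a,c$ have sum greater than $\pi$. A *barrier* is a quasi-regular triangle or a face of a simplex of the Q-system; $x$ and $w$ are obstructed from each other if the segment $xw$ meets the relative interior of a barrier. The *V-cell* at $v\in\Lambda$ is the set of points $x$ that are unobstructed from $v$ and no closer to any other vertex from which they are unobstructed. The *decomposition star* $D^*$ at $v\in\Lambda$ consists of the V-cell at $v$ and the simplices of the Q-system with vertex $v$. The *standard regions* are the closures of the connected components of the complement, in the unit sphere around $v$, of the radial projections from $v$ of the edges $\{w_1,w_2\}$ of the quasi-regular triangles $\{v,w_1,w_2\}$. The *standard cluster* $R$ over a standard region $P$ is the part of the star over $P$; $\operatorname{sol}(R)$ is the area of $P$. **Score.** For a body $X$ that is star shaped around the apex of a cone of solid angle $\omega$ put $s(X,\omega)=4(-\delta_{oct}\operatorname{vol}X+\omega/3)$. For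 a simplex $S$ with vertex $v$: $\Gamma(S)=-\delta_{oct}\operatorname{vol}S+\frac13\sum_{x}\operatorname{sol}(S,x)$, the sum running over the vertices $x$ of $S$; $\operatorname{vor}(S,v)=s(\cdot,\operatorname{sol}(S,v))$ for the analytic continuation, from the simplices that contain their circumcentre, of the volume of the part of $S$ closest to $v$ (that is, the sum of the signed volumes of the six Rogers simplices of $S$ at $v$); and $\operatorname{vor}_0(S,v)=s(\cdot,\operatorname{sol}(S,v))$ for the part of the cone over $S$ at $v$ that lies within $t_0$ of $v$ and is at least as close to $v$ as to the other vertices of $S$. A quasi-regular tetrahedron $S$ has score $\sigma(S)=\Gamma(S)$ if its circumradius is less than $1.41$, and $\operatorname{vor}(S,v)$ otherwise. For a strict quarter $S$ put $\mu(S,v)=\Gamma(S)$ if both faces along its diagonal have circumradius less than $\sqrt2$, and $\mu(S,v)=\operatorname{vor}(S,v)$ otherwise. If $v$ is not on the diagonal, $\sigma(S)=\mu(S,v)$. If the diagonal is $\{v,\hat v\}$, with $m$ anchors and $m-n$ strict quarters along it, then $\sigma(S)=\mu(S,v)$ when $(m,n)=(2,1)$, $\sigma(S)=\frac12(\mu(S,v)+\mu(S,\hat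 v))$ when $(m,n)=(4,0)$, and $\sigma(S)=\frac12(\mu(S,v)+\mu(S,\hat v)+\operatorname{vor}_0(S,v)-\operatorname{vor}_0(S,\hat v))$ otherwise. The score $\sigma(R)$ of a standard cluster over $P$ is the sum of $\sigma(S)$ over its simplices $S$ plus $s(X,\omega)$, where $X$ is the part of the V-cell over the part of $P$ not covered by these simplices and $\omega$ is the area of that part of $P$. Put $$\sigma_\lambda(R)=\sigma(R)-\lambda\,\zeta\operatorname{sol}(R)\,pt,\qquad \tau(R)=-\sigma_1(R),\qquad \sigma(D^*)=\sum_R\sigma(R),\qquad \tau(D^*)=\sum_R\tau(R),$$ where the sums run over the standard clusters of $D^*$. **Lemma 3.2.** Every decomposition star $D^*$ has finitely many standard clusters, and $$\sigma(D^*)=4\pi\zeta\,pt-\tau(D^*).$$ Hence, for every real $c$, $\tau(D^*)\ge c$ if and only if $\sigma(D^*)\le 4\pi\zeta\,pt-c$. Moreover the score $s_0=4\pi\zeta\,pt$ corresponds to Rogers's bound $\sqrt2/\zeta$, in the sense that its effective density is $$\frac{16\pi\,\delta_{oct}}{16\pi-3s_0}=\frac{\sqrt2}{\zeta}.$$ 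-/

import Mathlib

namespace Kepler

open MeasureTheory

/-- Euclidean three-space. -/
abbrev E3 : Type := EuclideanSpace ℝ (Fin 3)

/-! ### Constants -/

/-- `ζ⁻¹ = 2 arctan (√2 / 5)`, the solid angle of the regular tetrahedron at a vertex. -/
noncomputable def zeta : ℝ := (2 * Real.arctan (Real.sqrt 2 / 5))⁻¹

/-- One point. -/
noncomputable def pt : ℝ := 2 / zeta - Real.pi / 3

/-- `δ_oct`. -/
noncomputable def deltaOct : ℝ := (Real.pi - 2 / zeta) / Real.sqrt 8

/-- The truncation radius. -/
noncomputable def t0 : ℝ := 1.255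

/-- Rogers's bound on the density of sphere packings. -/
noncomputable def rogersBound : ℝ := Real.sqrt 2 / zeta

/-- The effective density that corresponds to a score `s`. -/
noncomputable def effectiveDensity (s : ℝ) : ℝ :=
  16 * Real.pi * deltaOct / (16 * Real.pi - 3 * s)

/-! ### Elementary geometry -/

/-- The radial projection of `X`, from the point `v`, to the unit sphere centred at the origin:
all directions in which a point of `X` is seen from `v`. -/
def radialProj (v : E3) (X : Set E3) : Set E3 :=
  {u | u ∈ Metric.sphere (0 : E3) 1 ∧ ∃ t : ℝ, 0 < t ∧ v + t • u ∈ X}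

/-- The cone with apex `v` over a set `A` of directions. -/
def coneOver (v : E3) (A : Set E3) : Set E3 :=
  {x | ∃ u ∈ A, ∃ t : ℝ, 0 < t ∧ x = v + t • u}

/-- The area of a subset of the unit sphere (the whole sphere has area `4π`). -/
noncomputable def sol (A : Set E3) : ℝ :=
  ((volume : Measure E3).toSphere).real
    ((fun u : Metric.sphere (0 : E3) 1 => (u : E3)) ⁻¹' A)

/-- The solid angle of the simplex with vertex set `S` at its vertex `v`. -/
noncomputable def simplexSol (S : Set E3) (v : E3) : ℝ :=
  sol (radialProj v (convexHull ℝ S))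

open Classical in
/-- The circumcentre of an affinely independent tuple of points. -/
noncomputable def circumcenter {n : ℕ} (p : Fin (n + 1) → E3) : E3 :=
  if h : AffineIndependent ℝ p then (Affine.Simplex.mk p h).circumcenter else p 0

/-- The circumradius of an affinely independent tuple of points. -/
noncomputable def circumradius {n : ℕ} (p : Fin (n + 1) → E3) : ℝ :=
  dist (p 0) (circumcenter p)

/-- The dihedral angle along the edge `p q` between the half-planes through `a` and `b`. -/
noncomputable def dih (p q a b : E3) : ℝ :=
  InnerProductGeometry.angle
    ((Submodule.span ℝ {q - p})ᗮ.starProjection (a - p))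
    ((Submodule.span ℝ {q - p})ᗮ.starProjection (b - p))

/-- Two simplices overlap if the interiors of their convex hulls meet. -/
def Overlap (S S' : Set E3) : Prop :=
  (interior (convexHull ℝ S) ∩ interior (convexHull ℝ S')).Nonempty

/-! ### Packings, quasi-regular simplices, quarters -/

/-- The centres of a packing by balls of radius one. -/
def IsPacking (L : Set E3) : Prop := ∀ x ∈ L, ∀ y ∈ L, x ≠ y → 2 ≤ dist x y

/-- No further ball can be added to the packing. -/
def IsSaturated (L : Set E3) : Prop := ∀ x : E3, ∃ y ∈ L, dist x y < 2

def QuasiRegularTriangle (L T : Set E3) : Prop :=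
  T ⊆ L ∧ T.ncard = 3 ∧ ∀ x ∈ T, ∀ y ∈ T, dist x y ≤ 2.51

def QuasiRegularTetrahedron (L S : Set E3) : Prop :=
  S ⊆ L ∧ S.ncard = 4 ∧ ∀ x ∈ S, ∀ y ∈ S, dist x y ≤ 2.51

/-- A strict diagonal of the packing. -/
def StrictDiagonal (L : Set E3) (p q : E3) : Prop :=
  p ∈ L ∧ q ∈ L ∧ 2.51 < dist p q ∧ dist p q < Real.sqrt 8

/-- `S` is a strict quarter with diagonal `{p, q}`. -/
def StrictQuarter (L : Set E3) (p q : E3) (S : Set E3) : Prop :=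
  StrictDiagonal L p q ∧
    ∃ a ∈ L, ∃ b ∈ L, S = {p, q, a, b} ∧ S.ncard = 4 ∧
      dist p a ≤ 2.51 ∧ dist p b ≤ 2.51 ∧ dist q a ≤ 2.51 ∧ dist q b ≤ 2.51 ∧
      dist a b ≤ 2.51

/-- The anchors of the diagonal `{p, q}`. -/
def anchors (L : Set E3) (p q : E3) : Set E3 :=
  {w | w ∈ L ∧ dist w p ≤ 2.51 ∧ dist w q ≤ 2.51}

/-- The diagonal `{p, q}` has context `(m, n)`: it has `m` anchors, and there are `m - n`
quarters along it. -/
def HasContext (L : Set E3) (p q : E3) (m n : ℕ) : Prop :=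
  (anchors L p q).ncard = m ∧ {S | StrictQuarter L p q S}.ncard + n = m

/-- `O` is the set of the six vertices of a quartered octahedron: four strict quarters along the
diagonal `{p, q}`, each adjacent to the next one in cyclic order. -/
def QuarteredOctahedron (L O : Set E3) (p q : E3) : Prop :=
  ∃ a b c e : E3, O = {p, q, a, b, c, e} ∧ O.ncard = 6 ∧
    StrictQuarter L p q {p, q, a, b} ∧ StrictQuarter L p q {p, q, b, c} ∧
    StrictQuarter L p q {p, q, c, e} ∧ StrictQuarter L p q {p, q, e, a}

/-! ### The Q-system -/

/-- The simplices of the Q-system. A quartered octahedron may be cut into four quarters along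
more than one of its diagonals; `diag` is a fixed choice of a diagonal for each of them. -/
inductive QSystem (L : Set E3) (diag : Set E3 → E3 × E3) : Set E3 → Prop
  /-- All quasi-regular tetrahedra. -/
  | tetrahedron {S : Set E3} (h : QuasiRegularTetrahedron L S) : QSystem L diag S
  /-- Strict quarters such that no quarter along the diagonal overlaps any other
  quasi-regular tetrahedron or strict quarter. -/
  | free {S : Set E3} {p q : E3} (h : StrictQuarter L p q S)
      (hfree : ∀ Q, StrictQuarter L p q Q → ∀ S', S' ≠ Q →
        (QuasiRegularTetrahedron L S' ∨ ∃ p' q', StrictQuarter L p' q' S') → ¬ Overlap Q S') :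
      QSystem L diag S
  /-- Strict quarters whose diagonal has four or more anchors, unless there are exactly four
  anchors and they are arranged as a quartered octahedron. -/
  | anchored {S : Set E3} {p q : E3} (h : StrictQuarter L p q S)
      (hfour : 4 ≤ (anchors L p q).ncard)
      (hoct : ¬ ((anchors L p q).ncard = 4 ∧ ∃ O, QuarteredOctahedron L O p q)) :
      QSystem L diag S
  /-- The four quarters along the chosen diagonal of a quartered octahedron. -/
  | octahedron {S O : Set E3} (hO : QuarteredOctahedron L O (diag O).1 (diag O).2)
      (h : StrictQuarter L (diag O).1 (diag O).2 S) (hS : S ⊆ O) : QSystem L diag S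
  /-- Pairs of adjacent strict quarters `{p, q, a, b}`, `{p, q, a, c}` with exactly three anchors
  `a`, `b`, `c` along the diagonal `{p, q}`, in conflict with a second strict diagonal `{b, c}`,
  which has exactly the anchors `p`, `q`, `a`, when `{p, q}` is the diagonal that passes through
  the triangle formed by the other diagonal and the vertex `a`. The conditions are those for
  `{p, q, a, b}`; exchanging `b` and `c` gives those for `{p, q, a, c}`. -/
  | conflict {p q a b c : E3} (h : StrictQuarter L p q {p, q, a, b})
      (hcard : (anchors L p q).ncard = 3) (hanchors : anchors L p q = {a, b, c})
      (hdiag : StrictDiagonal L b c) (hanchors' : anchors L b c = {p, q, a})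
      (hdih : Real.pi < dih p q a b + dih p q a c) :
      QSystem L diag {p, q, a, b}

/-! ### Decomposition stars -/

/-- The data determining a decomposition star: a saturated packing, one of its vertices, and the
choices that enter into the Q-system. -/
structure DecompositionStar where
  /-- the packing -/
  L : Set E3
  packing : IsPacking L
  saturated : IsSaturated L
  /-- the vertex at which the star is situated -/
  center : E3
  center_mem : center ∈ L
  /-- the chosen diagonal of each quartered octahedron -/
  diag : Set E3 → E3 × E3
  diag_spec : ∀ O p q, QuarteredOctahedron L O p q →
    QuarteredOctahedron L O (diag O).1 (diag O).2

namespace DecompositionStar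

variable (D : DecompositionStar)

/-- A barrier: a quasi-regular triangle, or a face of a simplex in the Q-system. -/
def Barrier (T : Set E3) : Prop :=
  QuasiRegularTriangle D.L T ∨ ∃ S, QSystem D.L D.diag S ∧ T ⊆ S ∧ T.ncard = 3

/-- `x` and `w` are obstructed from each other by a barrier. -/
def Obstructed (x w : E3) : Prop :=
  ∃ T, D.Barrier T ∧ (segment ℝ x w ∩ intrinsicInterior ℝ (convexHull ℝ T)).Nonempty

/-- The V-cell at the centre of the star: the points that are unobstructed from the centre and
that are no closer to any other vertex from which they are unobstructed. -/
def VCell : Set E3 :=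
  {x | ¬ D.Obstructed x D.center ∧
    ∀ w ∈ D.L, ¬ D.Obstructed x w → dist x D.center ≤ dist x w}

/-- The simplices of the star: those in the Q-system that have a vertex at its centre. -/
def simplices : Set (Set E3) := {S | QSystem D.L D.diag S ∧ D.center ∈ S}

/-! ### Standard regions and standard clusters -/

/-- The arcs on the unit sphere obtained by projecting the edges `{w₁, w₂}` of the quasi-regular
triangles `{center, w₁, w₂}`. -/
def arcs : Set E3 :=
  {u | ∃ w₁ w₂, QuasiRegularTriangle D.L {D.center, w₁, w₂} ∧
    u ∈ radialProj D.center (segment ℝ w₁ w₂)}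

/-- The standard regions: the closures of the connected components of the complement of the arcs
in the unit sphere. -/
def standardRegions : Set (Set E3) :=
  {P | ∃ u ∈ Metric.sphere (0 : E3) 1 \ D.arcs,
    P = closure (connectedComponentIn (Metric.sphere (0 : E3) 1 \ D.arcs) u)}

/-- The simplices of the standard cluster over the region `P`. -/
def simplicesOver (P : Set E3) : Set (Set E3) :=
  {S | S ∈ D.simplices ∧ radialProj D.center (convexHull ℝ S) ⊆ P}

/-- The directions in the region `P` that are not covered by simplices of the cluster. -/
def freeDirections (P : Set E3) : Set E3 :=
  P \ ⋃ S ∈ D.simplicesOver P, radialProj D.center (convexHull ℝ S)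

/-- The part of the V-cell in the standard cluster over `P`, outside the simplices. -/
def cellOver (P : Set E3) : Set E3 := D.VCell ∩ coneOver D.center (D.freeDirections P)

end DecompositionStar

/-! ### Scores -/

/-- `4 (-δ_oct · vol X + ω / 3)`, the score of a region `X` that is star shaped around the
apex of a cone of solid angle `ω`. -/
noncomputable def voronoiScore (vol ω : ℝ) : ℝ := 4 * (-deltaOct * vol + ω / 3)

/-- The compression of a simplex. -/
noncomputable def compression (S : Set E3) : ℝ :=
  -deltaOct * (volume : Measure E3).real (convexHull ℝ S) + ∑ᶠ x ∈ S, (simplexSol S x / 3)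

/-- The determinant of three vectors. -/
noncomputable def det3 (x y z : E3) : ℝ :=
  Matrix.det (Matrix.of fun i j : Fin 3 => (![x, y, z] i) j)

/-- The signed volume of the Rogers simplex with vertices `v`, the midpoint of `{v, a}`, the
circumcentre of `{v, a, b}`, and the circumcentre of `{v, a, b, c}`. -/
noncomputable def rogersVol (v a b c : E3) : ℝ :=
  SignType.sign (det3 (a - v) (b - v) (c - v)) *
    det3 ((1 / 2 : ℝ) • (a - v)) (circumcenter ![v, a, b] - v)
      (circumcenter ![v, a, b, c] - v) / 6

/-- The analytic continuation (from the simplices that contain their circumcentre) of the volume of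
the part of the simplex `S` that is closer to `v` than to the other vertices, as the sum of the
signed volumes of the six Rogers simplices at `v`. -/
noncomputable def analyticVol (S : Set E3) (v : E3) : ℝ :=
  ∑ᶠ t ∈ {t : E3 × E3 × E3 | S = {v, t.1, t.2.1, t.2.2}}, rogersVol v t.1 t.2.1 t.2.2

/-- The analytic Voronoi function of the simplex `S` at `v`. -/
noncomputable def vor (S : Set E3) (v : E3) : ℝ :=
  voronoiScore (analyticVol S v) (simplexSol S v)

/-- The Voronoi function of the simplex `S` at `v`, truncated at radius `t₀`. -/
noncomputable def vor0 (S : Set E3) (v : E3) : ℝ :=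
  voronoiScore
    ((volume : Measure E3).real
      {x | x ∈ coneOver v (radialProj v (convexHull ℝ S)) ∧ dist x v ≤ t0 ∧
        ∀ w ∈ S, dist x v ≤ dist x w})
    (simplexSol S v)

open Classical in
/-- The score of a quasi-regular tetrahedron: compression if the circumradius is less than `1.41`,
and the analytic Voronoi function otherwise. -/
noncomputable def tetrahedronScore (S : Set E3) (v : E3) : ℝ :=
  if ∃ a b c, S = {v, a, b, c} ∧ circumradius ![v, a, b, c] < 1.41 then compression S
  else vor S v

open Classical in
/-- The function `μ` of a strict quarter with diagonal `{p, q}`: compression if the two faces along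
the diagonal have circumradius less than `√2`, and the analytic Voronoi function otherwise. -/
noncomputable def mu (S : Set E3) (p q v : E3) : ℝ :=
  if ∀ x ∈ S, x ≠ p → x ≠ q → circumradius ![p, q, x] < Real.sqrt 2 then compression S
  else vor S v

open Classical in
/-- The score, as an upright quarter at `v`, of a strict quarter with diagonal `{v, v'}`. -/
noncomputable def uprightScore (L S : Set E3) (v v' : E3) : ℝ :=
  if HasContext L v v' 2 1 then mu S v v' v
  else if HasContext L v v' 4 0 then (mu S v v' v + mu S v v' v') / 2
  else (mu S v v' v + mu S v v' v') / 2 + (vor0 S v - vor0 S v') / 2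

open Classical in
/-- The score at `v` of a quasi-regular tetrahedron or a strict quarter `S` (with `v ∈ S`). The
quarter is upright if `v` lies on the diagonal, and flat otherwise. -/
noncomputable def simplexScore (L S : Set E3) (v : E3) : ℝ :=
  if QuasiRegularTetrahedron L S then tetrahedronScore S v
  else if h : ∃ v', StrictQuarter L v v' S then uprightScore L S v h.choose
  else if h : ∃ d : E3 × E3, StrictQuarter L d.1 d.2 S then mu S h.choose.1 h.choose.2 v
  else 0

namespace DecompositionStar

variable (D : DecompositionStar)

/-- The score `σ(R)` of the standard cluster `R` over the region `P`. -/
noncomputable def clusterScore (P : Set E3) : ℝ :=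
  (∑ᶠ S ∈ D.simplicesOver P, simplexScore D.L S D.center) +
    voronoiScore ((volume : Measure E3).real (D.cellOver P)) (sol (D.freeDirections P))

/-- `σ_l(R) = σ(R) - l ζ sol(R) pt`. -/
noncomputable def clusterScoreShifted (l : ℝ) (P : Set E3) : ℝ :=
  D.clusterScore P - l * zeta * sol P * pt

/-- `τ(R) = -σ₁(R)`, the amount squandered by the standard cluster over `P`. -/
noncomputable def clusterTau (P : Set E3) : ℝ := -D.clusterScoreShifted 1 P

/-- The score of the star: the sum of the scores of its standard clusters. -/
noncomputable def score : ℝ := ∑ᶠ P ∈ D.standardRegions, D.clusterScore P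

/-- The amount squandered by the star: the sum over its standard clusters. -/
noncomputable def tau : ℝ := ∑ᶠ P ∈ D.standardRegions, D.clusterTau P

end DecompositionStar

end Kepler

/-!
The scores satisfy `σ(R) + τ(R) = ζ pt sol(R)` on each standard cluster `R`, by definition, so the
identity `σ(D*) + τ(D*) = 4π ζ pt` says that there are finitely many standard regions and that
their areas add up to `4π`, the area of the unit sphere.

Only finitely many vertices lie within `2.51` of the centre of the star, so the arcs that bound
the standard regions are finite in number. Each is compact, because the edge it comes from misses
the centre (`QuasiRegularTriangle.notMem_segment`), and each lies in a plane through the origin.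

* *Finiteness* (`finite_components_sphere_diff`): a finite family of planes through the origin cuts
  the sphere into finitely many cells, one for each vector of signs. Each cell is connected and
  misses the arcs, so it lies in one component of their complement; and each component, being open
  in the sphere, meets a cell, because the planes have dense complement. So there are no more
  components than cells.
* *Area* (`sum_sol_standardRegions`): a component is relatively closed in the complement of the
  arcs, so passing to its closure only adds points of the arcs. The standard regions therefore
  cover the sphere up to the arcs and overlap only along them, and the arcs have area zero.

Connectedness on the sphere is always obtained by normalising the points of a segment.
-/

namespace Kepler

open MeasureTheory Set Metric

open scoped RealInnerProductSpace

/-! ### Components of an open part of the unit sphere -/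

section Components

variable {E : Type*} [NormedAddCommGroup E] [InnerProductSpace ℝ E]

lemma norm_inv_norm_smul_sub_le {u : E} (hu : ‖u‖ = 1) (z : E) :
    ‖‖z‖⁻¹ • z - u‖ ≤ 2 * ‖z - u‖ := by
  rcases eq_or_ne z 0 with rfl | hz
  · simp [hu]
  have hz' : ‖z‖ ≠ 0 := norm_ne_zero_iff.2 hz
  have h1 : ‖‖z‖⁻¹ • z - z‖ = |‖u‖ - ‖z‖| := by
    have : ‖z‖⁻¹ • z - z = (‖z‖⁻¹ - 1) • z := by rw [sub_smul, one_smul]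
    rw [this, norm_smul, Real.norm_eq_abs, ← abs_norm z, ← abs_mul, abs_norm, hu, sub_mul,
      inv_mul_cancel₀ hz', one_mul]
  have h2 : |‖u‖ - ‖z‖| ≤ ‖z - u‖ := by
    rw [norm_sub_rev]
    exact abs_norm_sub_norm_le u z
  calc ‖‖z‖⁻¹ • z - u‖ = ‖(‖z‖⁻¹ • z - z) + (z - u)‖ := by rw [sub_add_sub_cancel]
    _ ≤ ‖‖z‖⁻¹ • z - z‖ + ‖z - u‖ := norm_add_le _ _
    _ ≤ 2 * ‖z - u‖ := by linarith

/-- Two points of the sphere lie in the same component of `U` if `U` contains the great arc between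
them, described as the normalisation of the segment between them. -/
lemma mem_connectedComponentIn_of_segment {U : Set E} {x y : E} (hx : ‖x‖ = 1) (hy : ‖y‖ = 1)
    (h0 : (0 : E) ∉ segment ℝ x y) (h : ∀ z ∈ segment ℝ x y, ‖z‖⁻¹ • z ∈ U) :
    y ∈ connectedComponentIn U x := by
  have hcont : ContinuousOn (fun z : E => ‖z‖⁻¹ • z) (segment ℝ x y) := by
    refine ContinuousOn.smul (ContinuousOn.inv₀ continuous_norm.continuousOn ?_) continuousOn_id
    rintro z hz hz0
    exact h0 (norm_eq_zero.1 hz0 ▸ hz)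
  have hpre := (convex_segment (𝕜 := ℝ) x y).isPreconnected.image _ hcont
  refine hpre.subset_connectedComponentIn (x := x) (F := U) ?_ ?_ ?_
  · exact ⟨x, left_mem_segment ℝ x y, by simp [hx]⟩
  · rintro _ ⟨z, hz, rfl⟩
    exact h z hz
  · exact ⟨y, right_mem_segment ℝ x y, by simp [hy]⟩

/-- The components of an open part of the unit sphere are open in the sphere. -/
lemma exists_ball_inter_sphere_subset_connectedComponentIn {A : Set E} (hA : IsClosed A) {u : E}
    (hu : u ∈ sphere (0 : E) 1 \ A) :
    ∃ r > 0, ball u r ∩ sphere 0 1 ⊆ connectedComponentIn (sphere 0 1 \ A) u := by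
  obtain ⟨r, hr, hrA⟩ := Metric.isOpen_iff.1 hA.isOpen_compl u hu.2
  have hu1 : ‖u‖ = 1 := by simpa using hu.1
  -- normalising at most doubles the distance to `u`, hence the factor `1 / 2`
  refine ⟨min (r / 2) 1, by positivity, ?_⟩
  rintro y ⟨hy, hy1⟩
  have hseg : ∀ z ∈ segment ℝ u y, ‖z - u‖ < min (r / 2) 1 := fun z hz => by
    have := (convex_ball u (min (r / 2) 1)).segment_subset
      (mem_ball_self (by positivity)) hy hz
    rwa [mem_ball, dist_eq_norm] at this
  have h0 : (0 : E) ∉ segment ℝ u y := fun h => by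
    have := hseg 0 h
    rw [zero_sub, norm_neg, hu1] at this
    exact absurd (this.trans_le (min_le_right _ _)) (lt_irrefl _)
  refine mem_connectedComponentIn_of_segment hu1 (by simpa using hy1) h0 fun z hz => ⟨?_, ?_⟩
  · have hz0 : z ≠ 0 := fun h => h0 (h ▸ hz)
    simp [norm_smul, hz0]
  · apply hrA
    rw [mem_ball, dist_eq_norm]
    have := norm_inv_norm_smul_sub_le hu1 z
    have := (hseg z hz).trans_le (min_le_left _ _)
    linarith

/-- Components are relatively closed, so the closure of one adds only points of `A`. -/
lemma closure_connectedComponentIn_diff_subset {A : Set E} (hA : IsClosed A) (u : E) :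
    closure (connectedComponentIn (sphere (0 : E) 1 \ A) u) \ A ⊆
      connectedComponentIn (sphere 0 1 \ A) u := by
  rintro y ⟨hy, hyA⟩
  have hy1 : y ∈ sphere (0 : E) 1 :=
    closure_minimal ((connectedComponentIn_subset _ _).trans sdiff_subset) isClosed_sphere hy
  obtain ⟨r, hr, hball⟩ :=
    exists_ball_inter_sphere_subset_connectedComponentIn hA ⟨hy1, hyA⟩
  obtain ⟨z, hzr, hz⟩ := _root_.mem_closure_iff.1 hy _ isOpen_ball (mem_ball_self hr)
  have hzy := hball ⟨hzr, (connectedComponentIn_subset _ _ hz).1⟩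
  rw [connectedComponentIn_eq hz, ← connectedComponentIn_eq hzy]
  exact mem_connectedComponentIn ⟨hy1, hyA⟩

lemma volume_inner_eq_zero [FiniteDimensional ℝ E] [MeasurableSpace E] [BorelSpace E] {n : E}
    (hn : n ≠ 0) : (volume : Measure E) {x | ⟪n, x⟫ = 0} = 0 := by
  have h : {x : E | ⟪n, x⟫ = 0} = ((ℝ ∙ n)ᗮ : Submodule ℝ E) := by
    ext x
    simp [Submodule.mem_orthogonal_singleton_iff_inner_right]
  rw [h]
  refine Measure.addHaar_submodule _ _ fun htop => hn ?_
  have : n ∈ (ℝ ∙ n)ᗮ := htop ▸ Submodule.mem_top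
  rwa [Submodule.mem_orthogonal_singleton_iff_inner_right, inner_self_eq_zero] at this

lemma dense_forall_inner_ne_zero [FiniteDimensional ℝ E] {ι : Type*} [Finite ι]
    {n : ι → E} (hn : ∀ i, n i ≠ 0) : Dense {x : E | ∀ i, ⟪n i, x⟫ ≠ 0} := by
  borelize E
  refine Measure.dense_of_ae (μ := (volume : Measure E)) ?_
  rw [ae_all_iff]
  exact fun i => measure_eq_zero_iff_ae_notMem.1 (volume_inner_eq_zero (hn i))

lemma inner_inv_norm_smul_ne_zero {n z : E} (h : ⟪n, z⟫ ≠ 0) : ⟪n, ‖z‖⁻¹ • z⟫ ≠ 0 := by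
  have hz : z ≠ 0 := by
    rintro rfl
    simp at h
  rw [inner_smul_right]
  exact mul_ne_zero (inv_ne_zero (norm_ne_zero_iff.2 hz)) h

/-- The complement in the unit sphere of a closed set that is contained in finitely many hyperplanes
through the origin has finitely many components. At least one hyperplane is needed for the sign
cells to be connected, since in dimension one the sphere itself is not. -/
lemma finite_components_sphere_diff [FiniteDimensional ℝ E] {ι : Type*} [Finite ι] [Nonempty ι]
    {n : ι → E} (hn : ∀ i, n i ≠ 0) {A : Set E} (hA : IsClosed A)
    (hAn : ∀ x ∈ A, ∃ i, ⟪n i, x⟫ = 0) :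
    {C | ∃ u ∈ sphere (0 : E) 1 \ A, C = connectedComponentIn (sphere 0 1 \ A) u}.Finite := by
  classical
  set U := sphere (0 : E) 1 \ A
  let sg : E → ι → SignType := fun x i => SignType.sign ⟪n i, x⟫
  let G : Set E := {y | ‖y‖ = 1 ∧ ∀ i, ⟪n i, y⟫ ≠ 0}
  have hGU : ∀ y ∈ G, y ∈ U := fun y hy =>
    ⟨by simpa using hy.1, fun hyA => (hAn y hyA).elim fun i hi => hy.2 i hi⟩
  have hcell : ∀ x ∈ G, ∀ y ∈ G, sg x = sg y → y ∈ connectedComponentIn U x := by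
    intro x hx y hy hxy
    have hgen : ∀ z ∈ segment ℝ x y, ∀ i, ⟪n i, z⟫ ≠ 0 := by
      rintro z ⟨a, b, ha, hb, hab, rfl⟩ i
      have hi : SignType.sign ⟪n i, x⟫ = SignType.sign ⟪n i, y⟫ := congrFun hxy i
      rw [inner_add_right, inner_smul_right, inner_smul_right]
      rcases lt_or_gt_of_ne (hx.2 i) with h | h
      · rw [sign_neg h, eq_comm, sign_eq_neg_one_iff] at hi
        exact (convex_Iio (0 : ℝ) h hi ha hb hab).ne
      · rw [sign_pos h, eq_comm, sign_eq_one_iff] at hi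
        exact (convex_Ioi (0 : ℝ) h hi ha hb hab).ne'
    have h0 : (0 : E) ∉ segment ℝ x y := fun h =>
      hgen 0 h (Classical.arbitrary ι) (inner_zero_right _)
    refine mem_connectedComponentIn_of_segment hx.1 hy.1 h0 fun z hz => hGU _ ⟨?_, fun i => ?_⟩
    · have hz0 : z ≠ 0 := fun h => h0 (h ▸ hz)
      simp [norm_smul, hz0]
    · exact inner_inv_norm_smul_ne_zero (hgen z hz i)
  -- the component that contains the cell with sign vector `s`, if this cell is not empty
  let F : (ι → SignType) → Set E := fun s =>
    if h : ∃ y ∈ G, sg y = s then connectedComponentIn U h.choose else ∅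
  refine (finite_range F).subset ?_
  rintro _ ⟨u, hu, rfl⟩
  obtain ⟨r, hr, hball⟩ := exists_ball_inter_sphere_subset_connectedComponentIn hA hu
  obtain ⟨z, hz, hzu⟩ := (dense_forall_inner_ne_zero hn).exists_dist_lt u (half_pos hr)
  have hy : ‖z‖⁻¹ • z ∈ G := by
    refine ⟨?_, fun i => inner_inv_norm_smul_ne_zero (hz i)⟩
    have hz0 : z ≠ 0 := by
      rintro rfl
      exact hz (Classical.arbitrary ι) (inner_zero_right _)
    simp [norm_smul, hz0]
  have hyu : ‖z‖⁻¹ • z ∈ connectedComponentIn U u := by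
    refine hball ⟨?_, by simpa using hy.1⟩
    have := norm_inv_norm_smul_sub_le (u := u) (by simpa using hu.1) z
    rw [dist_comm, dist_eq_norm] at hzu
    rw [mem_ball, dist_eq_norm]
    linarith
  have hex : ∃ y ∈ G, sg y = sg (‖z‖⁻¹ • z) := ⟨_, hy, rfl⟩
  refine ⟨sg (‖z‖⁻¹ • z), ?_⟩
  simp only [F, dif_pos hex]
  rw [connectedComponentIn_eq hyu]
  exact connectedComponentIn_eq (hcell _ hex.choose_spec.1 _ hy hex.choose_spec.2)

end Components

/-! ### Area on the unit sphere -/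

lemma toSphere_real_univ : ((volume : Measure E3).toSphere).real univ = 4 * Real.pi := by
  rw [Measure.toSphere_real_apply_univ, measureReal_def, EuclideanSpace.volume_ball_fin_three]
  have h : (0 : ℝ) ≤ Real.pi * 4 / 3 := by positivity
  simp only [finrank_euclideanSpace_fin, ENNReal.ofReal_one, one_pow, one_mul,
    ENNReal.toReal_ofReal h]
  push_cast
  ring

/-- Great circles have area zero. -/
lemma toSphere_inner_eq_zero {n : E3} (hn : n ≠ 0) :
    (volume : Measure E3).toSphere {u | ⟪n, (u : E3)⟫ = 0} = 0 := by
  have hmeas : MeasurableSet {u : sphere (0 : E3) 1 | ⟪n, (u : E3)⟫ = 0} :=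
    (isClosed_eq (by fun_prop) continuous_const).measurableSet
  rw [Measure.toSphere_apply' _ hmeas]
  refine mul_eq_zero_of_right _ (measure_mono_null ?_ (volume_inner_eq_zero hn))
  rintro _ ⟨t, -, _, ⟨u, hu, rfl⟩, rfl⟩
  have hu' : ⟪n, (u : E3)⟫ = 0 := hu
  simp [inner_smul_right, hu']

/-! ### Quasi-regular triangles at a vertex -/

lemma IsPacking.finite_inter_closedBall {L : Set E3} (hL : IsPacking L) (v : E3) (r : ℝ) :
    (L ∩ closedBall v r).Finite := by
  obtain ⟨t, ht, hcover⟩ := Metric.totallyBounded_iff.1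
    (isCompact_closedBall v r).totallyBounded 1 one_pos
  refine Set.Finite.subset (ht.biUnion fun y _ => Set.Subsingleton.finite (s := L ∩ ball y 1) ?_)
    fun x hx => ?_
  · rintro a ⟨ha, hay⟩ b ⟨hb, hby⟩
    by_contra hab
    have := hL a ha b hb hab
    have := dist_triangle_right a b y
    rw [mem_ball] at hay hby
    linarith
  · obtain ⟨y, hy, hxy⟩ := mem_iUnion₂.1 (hcover hx.2)
    exact mem_iUnion₂.2 ⟨y, hy, hx.1, hxy⟩

lemma QuasiRegularTriangle.ne {L : Set E3} {v w₁ w₂ : E3}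
    (h : QuasiRegularTriangle L {v, w₁, w₂}) : v ≠ w₁ ∧ v ≠ w₂ := by
  have h3 := h.2.1
  constructor
  · rintro rfl
    rw [insert_eq_of_mem (mem_insert _ _)] at h3
    have := ncard_insert_le v {w₂}
    rw [ncard_singleton] at this
    omega
  · rintro rfl
    rw [insert_eq_of_mem (mem_insert_of_mem _ (mem_singleton v))] at h3
    have := ncard_insert_le w₁ {v}
    rw [ncard_singleton] at this
    omega

/-- The edge of a quasi-regular triangle misses the opposite vertex: otherwise its length would be
the sum of those of the other two edges, which is at least `4`. -/
lemma QuasiRegularTriangle.notMem_segment {L : Set E3} (hL : IsPacking L) {v w₁ w₂ : E3}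
    (h : QuasiRegularTriangle L {v, w₁, w₂}) : v ∉ segment ℝ w₁ w₂ := by
  intro hv
  have h1 := hL v (h.1 (by simp)) w₁ (h.1 (by simp)) h.ne.1
  have h2 := hL v (h.1 (by simp)) w₂ (h.1 (by simp)) h.ne.2
  have h12 := h.2.2 w₁ (by simp) w₂ (by simp)
  have := dist_add_dist_of_mem_segment hv
  rw [dist_comm w₁ v] at this
  norm_num at h12
  linarith

lemma isCompact_radialProj_segment {v w₁ w₂ : E3} (hv : v ∉ segment ℝ w₁ w₂) :
    IsCompact (radialProj v (segment ℝ w₁ w₂)) := by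
  have hne : ∀ x ∈ segment ℝ w₁ w₂, x - v ≠ 0 := fun x hx h => hv (sub_eq_zero.1 h ▸ hx)
  have hK : IsCompact (segment ℝ w₁ w₂) := by
    rw [segment_eq_image_lineMap]
    exact isCompact_Icc.image (by fun_prop)
  have himage : radialProj v (segment ℝ w₁ w₂) =
      (fun x => ‖x - v‖⁻¹ • (x - v)) '' segment ℝ w₁ w₂ := by
    ext u
    constructor
    · rintro ⟨hu, t, ht, hx⟩
      have hu1 : ‖u‖ = 1 := by simpa using hu
      refine ⟨_, hx, ?_⟩
      simp [norm_smul, hu1, abs_of_pos ht, smul_smul, ht.ne']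
    · rintro ⟨x, hx, rfl⟩
      have h0 := norm_ne_zero_iff.2 (hne x hx)
      refine ⟨by simp [norm_smul, h0], ‖x - v‖, by simpa using hne x hx, ?_⟩
      simpa [smul_smul, h0] using hx
  rw [himage]
  refine hK.image_of_continuousOn ?_
  exact ContinuousOn.smul (ContinuousOn.inv₀ (by fun_prop) fun x hx => norm_ne_zero_iff.2 (hne x hx))
    (by fun_prop)

/-- An arc lies on a great circle. -/
lemma exists_normal_radialProj_segment (v w₁ w₂ : E3) :
    ∃ n : E3, n ≠ 0 ∧ ∀ u ∈ radialProj v (segment ℝ w₁ w₂), ⟪n, u⟫ = 0 := by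
  classical
  set K : Submodule ℝ E3 := Submodule.span ℝ {w₁ - v, w₂ - v}
  have hlt : Module.finrank ℝ K < 3 := by
    have h := finrank_span_finset_le_card (R := ℝ) ({w₁ - v, w₂ - v} : Finset E3)
    rw [Finset.coe_pair] at h
    exact (h.trans Finset.card_le_two).trans_lt (by norm_num)
  have hne : Kᗮ ≠ ⊥ := by
    intro h
    rw [Submodule.orthogonal_eq_bot_iff] at h
    rw [h, finrank_top, finrank_euclideanSpace_fin] at hlt
    exact lt_irrefl _ hlt
  obtain ⟨n, hn, hn0⟩ := Submodule.exists_mem_ne_zero_of_ne_bot hne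
  refine ⟨n, hn0, ?_⟩
  rintro u ⟨-, t, ht, a, b, -, -, hab, h⟩
  have hmem : t • u ∈ K := by
    have : t • u = a • (w₁ - v) + b • (w₂ - v) := by
      calc t • u = (a • w₁ + b • w₂) - (a + b) • v := by rw [h, hab, one_smul, add_sub_cancel_left]
        _ = a • (w₁ - v) + b • (w₂ - v) := by module
    rw [this]
    exact K.add_mem (K.smul_mem _ (Submodule.subset_span (by simp)))
      (K.smul_mem _ (Submodule.subset_span (by simp)))
  have h0 := Submodule.inner_left_of_mem_orthogonal hmem hn
  rw [inner_smul_right] at h0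
  exact (mul_eq_zero.1 h0).resolve_left ht.ne'

/-! ### Standard regions -/

namespace DecompositionStar

variable (D : DecompositionStar)

/-- Pairs `(w₁, w₂)` that form a quasi-regular triangle with the centre of the star; these index the
arcs. -/
def TrianglePair : Type := {w : E3 × E3 // QuasiRegularTriangle D.L {D.center, w.1, w.2}}

instance : Finite D.TrianglePair := by
  have hfin := D.packing.finite_inter_closedBall D.center 2.51
  refine Set.Finite.to_subtype ((hfin.prod hfin).subset ?_)
  intro w hw
  exact ⟨⟨hw.1 (by simp), hw.2.2 _ (by simp) _ (by simp)⟩,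
    ⟨hw.1 (by simp), hw.2.2 _ (by simp) _ (by simp)⟩⟩

lemma arcs_eq_iUnion :
    D.arcs = ⋃ w : D.TrianglePair, radialProj D.center (segment ℝ w.1.1 w.1.2) := by
  ext u
  simp only [arcs, mem_ofPred_eq, mem_iUnion]
  exact ⟨fun ⟨w₁, w₂, h, hu⟩ => ⟨⟨(w₁, w₂), h⟩, hu⟩, fun ⟨w, hu⟩ => ⟨_, _, w.2, hu⟩⟩

lemma isClosed_arcs : IsClosed D.arcs := by
  rw [arcs_eq_iUnion]
  exact isClosed_iUnion_of_finite fun w =>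
    (isCompact_radialProj_segment (w.2.notMem_segment D.packing)).isClosed

/-- The arcs lie on finitely many great circles. -/
lemma exists_normals : ∃ n : D.TrianglePair → E3, (∀ w, n w ≠ 0) ∧
    ∀ u ∈ D.arcs, ∃ w, ⟪n w, u⟫ = 0 := by
  choose n hn h using fun w : D.TrianglePair =>
    exists_normal_radialProj_segment D.center w.1.1 w.1.2
  refine ⟨n, hn, fun u hu => ?_⟩
  rw [arcs_eq_iUnion, mem_iUnion] at hu
  obtain ⟨w, hw⟩ := hu
  exact ⟨w, h w u hw⟩

lemma toSphere_arcs : (volume : Measure E3).toSphere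
    ((fun u : sphere (0 : E3) 1 => (u : E3)) ⁻¹' D.arcs) = 0 := by
  obtain ⟨n, hn, h⟩ := D.exists_normals
  refine measure_mono_null (fun u hu => ?_)
    (measure_iUnion_null fun w => toSphere_inner_eq_zero (hn w))
  exact mem_iUnion.2 (h u hu)

lemma standardRegions_finite : D.standardRegions.Finite := by
  obtain ⟨n, hn, h⟩ := D.exists_normals
  obtain ⟨e, he⟩ := exists_ne (0 : E3)
  -- a further plane is added because there may be no arcs at all
  let m : Option D.TrianglePair → E3 := fun o => o.elim e n
  have hm : ∀ o, m o ≠ 0 := by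
    rintro (_ | w)
    exacts [he, hn w]
  have hfin := finite_components_sphere_diff hm D.isClosed_arcs fun u hu =>
    (h u hu).imp' some fun _ hw => hw
  refine (hfin.image closure).subset ?_
  rintro _ ⟨u, hu, rfl⟩
  exact ⟨_, ⟨u, hu, rfl⟩, rfl⟩

/-- Distinct standard regions overlap only along the arcs. -/
lemma inter_subset_arcs {P Q : Set E3} (hP : P ∈ D.standardRegions) (hQ : Q ∈ D.standardRegions)
    (hPQ : P ≠ Q) : P ∩ Q ⊆ D.arcs := by
  obtain ⟨u, -, rfl⟩ := hP
  obtain ⟨v, -, rfl⟩ := hQ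
  rintro x ⟨hxu, hxv⟩
  by_contra hx
  apply hPQ
  rw [connectedComponentIn_eq
      (closure_connectedComponentIn_diff_subset D.isClosed_arcs u ⟨hxu, hx⟩),
    connectedComponentIn_eq
      (closure_connectedComponentIn_diff_subset D.isClosed_arcs v ⟨hxv, hx⟩)]

lemma sum_sol_standardRegions : ∑ᶠ P ∈ D.standardRegions, sol P = 4 * Real.pi := by
  have hfin := D.standardRegions_finite
  rw [finsum_mem_eq_finite_toFinset_sum _ hfin, ← toSphere_real_univ]
  simp only [sol]
  rw [← measureReal_biUnion_finset₀]
  · refine measureReal_congr ?_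
    rw [Filter.eventuallyEq_univ, mem_ae_iff]
    refine measure_mono_null (fun u hu => ?_) D.toSphere_arcs
    by_contra hua
    refine hu (mem_iUnion₂.2 ⟨closure (connectedComponentIn (sphere 0 1 \ D.arcs) u), ?_, ?_⟩)
    · exact hfin.mem_toFinset.2 ⟨u, ⟨u.2, hua⟩, rfl⟩
    · exact subset_closure (mem_connectedComponentIn ⟨u.2, hua⟩)
  · intro P hP Q hQ hPQ
    refine measure_mono_null (fun u hu => ?_) D.toSphere_arcs
    exact D.inter_subset_arcs (hfin.mem_toFinset.1 hP) (hfin.mem_toFinset.1 hQ) hPQ hu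
  · intro P hP
    obtain ⟨u, -, rfl⟩ := hfin.mem_toFinset.1 hP
    exact (isClosed_closure.preimage continuous_subtype_val).measurableSet.nullMeasurableSet

lemma score_add_tau : D.score + D.tau = 4 * Real.pi * zeta * pt := by
  rw [score, tau, ← finsum_mem_add_distrib D.standardRegions_finite]
  calc ∑ᶠ P ∈ D.standardRegions, (D.clusterScore P + D.clusterTau P)
      = ∑ᶠ P ∈ D.standardRegions, zeta * pt * sol P :=
        finsum_mem_congr rfl fun P _ => by
          rw [clusterTau, clusterScoreShifted]
          ring
    _ = 4 * Real.pi * zeta * pt := by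
        rw [← mul_finsum_mem, sum_sol_standardRegions]
        ring

end DecompositionStar

/-! ### Rogers's bound -/

/-- In `16π δ_oct / (16π - 3 s₀)` the factor `π ζ - 2` cancels, which is why it must not vanish:
`arctan (√2 / 5) < π / 4`. -/
lemma effectiveDensity_eq_rogersBound :
    effectiveDensity (4 * Real.pi * zeta * pt) = rogersBound := by
  have hlt : Real.arctan (Real.sqrt 2 / 5) < Real.pi / 4 := by
    rw [← Real.arctan_one]
    refine Real.arctan_strictMono ?_
    rw [div_lt_one (by norm_num), Real.sqrt_lt' (by norm_num)]
    norm_num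
  have hpos : 0 < Real.arctan (Real.sqrt 2 / 5) := Real.arctan_pos.2 (by positivity)
  have hz : 0 < zeta := inv_pos.2 (by linarith)
  have hπz : Real.pi * zeta - 2 ≠ 0 := by
    have h1 : zeta⁻¹ < Real.pi / 2 := by
      rw [zeta, inv_inv]
      linarith
    have h2 := mul_lt_mul_of_pos_left h1 hz
    rw [mul_inv_cancel₀ hz.ne'] at h2
    intro h
    linarith
  have h8 : Real.sqrt 8 = 2 * Real.sqrt 2 := by
    rw [show (8 : ℝ) = 2 ^ 2 * 2 by norm_num, Real.sqrt_mul (by norm_num),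
      Real.sqrt_sq (by norm_num)]
  have hs : Real.sqrt 2 ^ 2 = 2 := Real.sq_sqrt (by norm_num)
  have hnum : 16 * Real.pi * deltaOct =
      Real.sqrt 2 / zeta * (4 * Real.pi * (Real.pi * zeta - 2)) := by
    rw [deltaOct, h8]
    field_simp
    rw [hs]
    ring
  have hden : 16 * Real.pi - 3 * (4 * Real.pi * zeta * pt) =
      4 * Real.pi * (Real.pi * zeta - 2) := by
    rw [pt]
    field_simp
    ring
  rw [effectiveDensity, hnum, hden, rogersBound,
    mul_div_cancel_right₀ _ (mul_ne_zero (by positivity) hπz)]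

end Kepler

theorem lemma3p2 (D : Kepler.DecompositionStar) :
    D.standardRegions.Finite ∧
    D.score = 4 * Real.pi * Kepler.zeta * Kepler.pt - D.tau ∧
    (∀ c : ℝ, c ≤ D.tau ↔ D.score ≤ 4 * Real.pi * Kepler.zeta * Kepler.pt - c) ∧
    Kepler.effectiveDensity (4 * Real.pi * Kepler.zeta * Kepler.pt) = Kepler.rogersBound := by
  have h := D.score_add_tau
  refine ⟨D.standardRegions_finite, by linarith, fun c => ?_, Kepler.effectiveDensity_eq_rogersBound⟩
  constructor <;> intro hc <;> linarith
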